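/- Let $n,p\ge 1$, let $X\in\mathbb{R}^{n\times p}$ have orthonormal columns ($X^\top X=I_p$; an orthogonal design), let $\beta\in\mathbb{R}^p$ be arbitrary, and observe $y=X\beta+z$, where $z_1,\dots,z_n$ are i.i.d. $\mathcal N(0,1)$. Fix $q\in(0,1]$ and set $\lambda_i=\lambda_{\mathrm{BH}}(i)=\Phi^{-1}\bigl(1-\tfrac{iq}{2p}\bigr)$ for $i=1,\dots,p$, where $\Phi$ is the standard normal distribution function. For $b\in\mathbb{R}^p$ let $|b|_{(1)}\ge|b|_{(2)}\ge\dots\ge|b|_{(p)}$ be the absolute values of the entries of $b$ in decreasing order. Then for every $y\in\mathbb{R}^n$ the SLOPE problem $$\min_{b\in\mathbb{R}^p}\ \tfrac12\|y-Xb\|_{\ell_2}^2+\sum_{i=1}^p\lambda_i|b|_{(i)}$$ has exactly one solution. Denote it by $\hat\beta$, and let the SLOPE procedure reject $H_i:\beta_i=0$ exactly when $\hat\beta_i\neq 0$. Let $R=|\{i:\hat\beta_i\ne0\}|$ be the number of rejections, $V=|\{i:\beta_i=0,\ \hat\beta_i\neq0\}|$ the number of false rejections, and $p_0=|\{i:\beta_i=0\}|$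 the number of true null hypotheses. Then $V/(R\vee 1)$ is integrable (in particular, measurable up to a null set) and $$\mathrm{FDR}=\mathbb{E}\left[\frac{V}{R\vee1}\right]\le q\,\frac{p_0}{p}.$$ -/

import Mathlib

open MeasureTheory ProbabilityTheory

namespace SLOPE

noncomputable section

/-- `Φ⁻¹(α)`, the `α`th quantile of the standard normal distribution:
the smallest `x` with `α ≤ Φ(x)`. It is meaningful for `0 < α < 1`. -/
def normalQuantile (α : ℝ) : ℝ :=
  sInf {x : ℝ | α ≤ cdf (gaussianReal 0 1) x}

/-- The weights `λ_BH(i) = Φ⁻¹(1 - i q / (2 p))` for `i = 1, …, p`.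
The index `i : Fin p` starts at `0`, hence the shift by one. -/
def lambdaBH (p : ℕ) (q : ℝ) (i : Fin p) : ℝ :=
  normalQuantile (1 - ((i : ℝ) + 1) * q / (2 * (p : ℝ)))

/-- The order statistic of the magnitudes of `b`, in decreasing order:
`sortedAbs b 0 ≥ sortedAbs b 1 ≥ …` are the numbers `|b i|`, with multiplicity. -/
def sortedAbs {p : ℕ} (b : Fin p → ℝ) (k : Fin p) : ℝ :=
  |b (Tuple.sort (fun i => -|b i|) k)|

theorem sortedAbs_antitone {p : ℕ} (b : Fin p → ℝ) : Antitone (sortedAbs b) := by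
  intro i j hij
  have h := Tuple.monotone_sort (fun i => -|b i|) hij
  simpa [sortedAbs] using h

/-- The sorted `ℓ₁` norm `λ₁ |b|₍₁₎ + ⋯ + λ_p |b|₍p₎`. -/
def sortedL1 {p : ℕ} (lam : Fin p → ℝ) (b : Fin p → ℝ) : ℝ :=
  ∑ i, lam i * sortedAbs b i

/-- The objective `(1/2) ‖y - X b‖² + ∑ λ_i |b|₍i₎`, with the Euclidean norm. -/
def objective {n p : ℕ} (X : Matrix (Fin n) (Fin p) ℝ) (lam : Fin p → ℝ)
    (y : Fin n → ℝ) (b : Fin p → ℝ) : ℝ :=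
  (1 / 2) * ∑ j, (y j - X.mulVec b j) ^ 2 + sortedL1 lam b

/-- `b` is a SLOPE estimate for the response `y`: a global minimizer of the objective. -/
def IsEstimate {n p : ℕ} (X : Matrix (Fin n) (Fin p) ℝ) (lam : Fin p → ℝ)
    (y : Fin n → ℝ) (b : Fin p → ℝ) : Prop :=
  ∀ c : Fin p → ℝ, objective X lam y b ≤ objective X lam y c

/-- Orthogonal design: the columns of `X` have unit norm and are perpendicular. -/
def IsOrthogonalDesign {n p : ℕ} (X : Matrix (Fin n) (Fin p) ℝ) : Prop :=
  (∀ i, ∑ j, X j i ^ 2 = 1) ∧ ∀ i k, i ≠ k → ∑ j, X j i * X j k = 0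

/-- `p₀`, the number of true null hypotheses `H_i : β_i = 0`. -/
def numNulls {p : ℕ} (β : Fin p → ℝ) : ℕ :=
  (Finset.univ.filter fun i => β i = 0).card

/-- `R`, the number of rejections when `H_i` is rejected exactly if `b i ≠ 0`. -/
def numRejections {p : ℕ} (b : Fin p → ℝ) : ℕ :=
  (Finset.univ.filter fun i => b i ≠ 0).card

/-- `V`, the number of rejected true null hypotheses. -/
def numFalseRejections {p : ℕ} (β b : Fin p → ℝ) : ℕ :=
  (Finset.univ.filter fun i => β i = 0 ∧ b i ≠ 0).card

/-- The false discovery proportion `V / (R ∨ 1)`. -/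
def fdp {p : ℕ} (β b : Fin p → ℝ) : ℝ :=
  (numFalseRejections β b : ℝ) / max (numRejections b : ℝ) 1

end

end SLOPE

namespace SLOPE

noncomputable section

/-! Orthogonality turns the objective, up to a constant, into the proximal problem at `w = Xᵀy`,
whose coordinates are independent `N(β i, 1)`. Give an index set `A` the score `∑_{j∈A} |w j|` minus
the sum of the first `|A|` weights. Optimality of `b` yields `score A ≤ ∑_{j∈A} |b j| ≤ ∑_j |b j| ≤
score (supp b)`, so the support `S` of `b` maximizes the score and lies in every maximizer
(`isLeastMaximizer_coordSupport`).

Let `i ∈ S` and `|S| = r`. Deleting `i` strictly lowers the score, so `|w i|` exceeds the `r`th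
weight. Also, `r` is the least size of a best set among those containing `i`. This property ignores
`w i`, since changing `w i` shifts the scores of all such sets equally. The two events are therefore
independent. For a null `i` the first has probability at most `rq/p`, and the factor `1/r` from the
false discovery proportion cancels `r`. The second events are disjoint over `r`, so each null
contributes at most `q/p`. -/

/-- The least squares objective of the orthogonal design, up to an additive constant. -/
def proxObjective {p : ℕ} (lam w b : Fin p → ℝ) : ℝ :=
  (1 / 2) * ∑ i, (w i - b i) ^ 2 + sortedL1 lam b

/-- The sum of the first `k` weights. -/
def weightSum {p : ℕ} (lam : Fin p → ℝ) (k : ℕ) : ℝ :=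
  ∑ j : Fin p, if (j : ℕ) < k then lam j else 0

/-- The excess of the magnitudes of `w` over the leading weights on the index set `A`. -/
def score {p : ℕ} (lam w : Fin p → ℝ) (A : Finset (Fin p)) : ℝ :=
  ∑ j ∈ A, |w j| - weightSum lam A.card

/-- `S` is the least element among the sets of maximal score. -/
def IsLeastMaximizer {p : ℕ} (lam w : Fin p → ℝ) (S : Finset (Fin p)) : Prop :=
  ∀ A, score lam w A ≤ score lam w S ∧ (score lam w A = score lam w S → S ⊆ A)

/-- The set of nonzero coordinates. -/
def coordSupport {p : ℕ} (b : Fin p → ℝ) : Finset (Fin p) :=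
  Finset.univ.filter fun i => b i ≠ 0

/-! ### The sorted ℓ₁ norm -/

theorem mem_coordSupport {p : ℕ} {b : Fin p → ℝ} {i : Fin p} :
    i ∈ coordSupport b ↔ b i ≠ 0 := by
  simp [coordSupport]

theorem sortedAbs_ne_zero_iff {p : ℕ} (b : Fin p → ℝ) (k : Fin p) :
    sortedAbs b k ≠ 0 ↔ (k : ℕ) < (coordSupport b).card := by
  have hpos : ∀ j, 0 ≤ sortedAbs b j := fun j => abs_nonneg _
  set B := Finset.univ.filter fun j => sortedAbs b j ≠ 0 with hB
  have hcard : B.card = (coordSupport b).card := by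
    refine Finset.card_bij (fun j _ => Tuple.sort (fun i => -|b i|) j) ?_ ?_ ?_
    · intro j hj
      simpa [hB, sortedAbs, coordSupport] using hj
    · intro j _ j' _ h
      exact (Equiv.injective _) h
    · intro i hi
      refine ⟨(Tuple.sort (fun i => -|b i|)).symm i, ?_, by simp⟩
      simpa [hB, sortedAbs, coordSupport] using hi
  rw [← hcard]
  constructor
  · intro hk
    have : Finset.Iic k ⊆ B := by
      intro j hj
      have hjk := sortedAbs_antitone b (Finset.mem_Iic.1 hj)
      have : 0 < sortedAbs b k := lt_of_le_of_ne (hpos k) (Ne.symm hk)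
      simp only [hB, Finset.mem_filter, Finset.mem_univ, true_and]
      exact (this.trans_le hjk).ne'
    have := Finset.card_le_card this
    simp only [Fin.card_Iic] at this
    omega
  · intro hk h0
    have : B ⊆ Finset.Iio k := by
      intro j hj
      simp only [hB, Finset.mem_filter, Finset.mem_univ, true_and] at hj
      rw [Finset.mem_Iio]
      by_contra hle
      exact hj (le_antisymm ((sortedAbs_antitone b (not_lt.1 hle)).trans h0.le) (hpos j))
    have := Finset.card_le_card this
    simp only [Fin.card_Iio] at this
    omega

/-- Rearrangement inequality: the sorted norm is the maximum over all pairings of weights with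
magnitudes. Convexity of the penalty rests on this. -/
theorem sum_mul_comp_perm_le_sortedL1 {p : ℕ} {lam : Fin p → ℝ} (hlam : Antitone lam)
    (b : Fin p → ℝ) (σ : Equiv.Perm (Fin p)) :
    ∑ k, lam k * |b (σ k)| ≤ sortedL1 lam b := by
  have hmono : Monovary lam (sortedAbs b) := hlam.monovary (sortedAbs_antitone b)
  have := hmono.sum_mul_comp_perm_le_sum_mul
    (σ := σ.trans (Tuple.sort (fun i => -|b i|)).symm)
  simpa [sortedL1, sortedAbs] using this

theorem sortedL1_nonneg {p : ℕ} {lam : Fin p → ℝ} (h0 : ∀ i, 0 ≤ lam i) (b : Fin p → ℝ) :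
    0 ≤ sortedL1 lam b :=
  Finset.sum_nonneg fun i _ => mul_nonneg (h0 i) (abs_nonneg _)

theorem sortedL1_add_le {p : ℕ} {lam : Fin p → ℝ} (hlam : Antitone lam) (h0 : ∀ i, 0 ≤ lam i)
    (b c : Fin p → ℝ) : sortedL1 lam (b + c) ≤ sortedL1 lam b + sortedL1 lam c := by
  set σ := Tuple.sort (fun i => -|(b + c) i|) with hσ
  calc sortedL1 lam (b + c) = ∑ k, lam k * |b (σ k) + c (σ k)| := rfl
    _ ≤ ∑ k, (lam k * |b (σ k)| + lam k * |c (σ k)|) := by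
        gcongr with k
        rw [← mul_add]
        exact mul_le_mul_of_nonneg_left (abs_add_le _ _) (h0 k)
    _ ≤ _ := by
        rw [Finset.sum_add_distrib]
        exact add_le_add (sum_mul_comp_perm_le_sortedL1 hlam b σ)
          (sum_mul_comp_perm_le_sortedL1 hlam c σ)

theorem sortedL1_smul_le {p : ℕ} {lam : Fin p → ℝ} (hlam : Antitone lam)
    (b : Fin p → ℝ) {t : ℝ} (ht : 0 ≤ t) : sortedL1 lam (t • b) ≤ t * sortedL1 lam b := by
  set σ := Tuple.sort (fun i => -|(t • b) i|) with hσ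
  calc sortedL1 lam (t • b) = ∑ k, lam k * |t * b (σ k)| := rfl
    _ = t * ∑ k, lam k * |b (σ k)| := by
        rw [Finset.mul_sum]
        refine Finset.sum_congr rfl fun k _ => ?_
        rw [abs_mul, abs_of_nonneg ht]
        ring
    _ ≤ _ := mul_le_mul_of_nonneg_left (sum_mul_comp_perm_le_sortedL1 hlam b σ) ht

theorem sortedL1_le_mul_norm {p : ℕ} {lam : Fin p → ℝ} (h0 : ∀ i, 0 ≤ lam i)
    (b : Fin p → ℝ) : sortedL1 lam b ≤ (∑ i, lam i) * ‖b‖ := by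
  rw [Finset.sum_mul]
  exact Finset.sum_le_sum fun i _ =>
    mul_le_mul_of_nonneg_left (norm_le_pi_norm b _) (h0 i)

theorem sortedL1_eq_weightSum {p : ℕ} (lam : Fin p → ℝ) (c : Fin p → ℝ)
    (hc : ∀ j, c j ≠ 0 → |c j| = 1) : sortedL1 lam c = weightSum lam (coordSupport c).card := by
  refine Finset.sum_congr rfl fun k _ => ?_
  split_ifs with h <;> rw [← sortedAbs_ne_zero_iff] at h
  · have : c (Tuple.sort (fun i => -|c i|) k) ≠ 0 := by simpa [sortedAbs] using h
    simp [sortedAbs, hc _ this]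
  · rw [not_not.1 h, mul_zero]

/-! ### First-order optimality conditions -/

theorem nonneg_of_eventually_quadratic {a c : ℝ}
    (h : ∀ᶠ t in nhdsWithin (0 : ℝ) (Set.Ioi 0), 0 ≤ t * a + t ^ 2 * c) : 0 ≤ a := by
  have hlim : Filter.Tendsto (fun t : ℝ => a + t * c) (nhdsWithin 0 (Set.Ioi 0)) (nhds a) := by
    have : Continuous fun t : ℝ => a + t * c := by fun_prop
    simpa using (this.tendsto 0).mono_left nhdsWithin_le_nhds
  refine ge_of_tendsto hlim ?_
  filter_upwards [h, self_mem_nhdsWithin] with t ht (ht0 : 0 < t)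
  have : 0 ≤ t * (a + t * c) := by linarith [ht, show t * (a + t * c) = t * a + t ^ 2 * c by ring]
  exact (mul_nonneg_iff_of_pos_left ht0).1 this

theorem sum_sq_sub_add_smul {p : ℕ} (w b c : Fin p → ℝ) (t : ℝ) :
    ∑ i, (w i - (b + t • c) i) ^ 2 =
      ∑ i, (w i - b i) ^ 2 - 2 * t * ∑ i, (w i - b i) * c i + t ^ 2 * ∑ i, c i ^ 2 := by
  simp only [Finset.mul_sum, ← Finset.sum_sub_distrib, ← Finset.sum_add_distrib]
  refine Finset.sum_congr rfl fun i _ => ?_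
  simp only [Pi.add_apply, Pi.smul_apply, smul_eq_mul]
  ring

/-- Moving from `b` to `b + t c` raises the penalty by at most `t` times the norm of `c`; compare
the terms linear in `t`. This is dual feasibility of the residual. -/
theorem inner_residual_le_sortedL1 {p : ℕ} {lam : Fin p → ℝ} (hlam : Antitone lam)
    (h0 : ∀ i, 0 ≤ lam i) {w b : Fin p → ℝ}
    (hb : ∀ c, proxObjective lam w b ≤ proxObjective lam w c) (c : Fin p → ℝ) :
    ∑ i, (w i - b i) * c i ≤ sortedL1 lam c := by
  rw [← sub_nonneg]
  refine nonneg_of_eventually_quadratic (c := (1 / 2) * ∑ i, c i ^ 2) ?_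
  filter_upwards [self_mem_nhdsWithin] with t (ht : 0 < t)
  have h1 := hb (b + t • c)
  simp only [proxObjective, sum_sq_sub_add_smul] at h1
  have h2 := sortedL1_add_le hlam h0 b (t • c)
  have h3 := sortedL1_smul_le hlam c ht.le
  linarith

/-- No nonzero entry reaches zero, so the support is kept and occupies the leading positions when
the shrunk vector is sorted. Each leading weight thus loses `t`; what remains is a pairing for `b`,
bounded by rearrangement. -/
theorem sortedL1_shrink_le {p : ℕ} {lam : Fin p → ℝ} (hlam : Antitone lam) (b : Fin p → ℝ)
    {t : ℝ} (htb : ∀ j, b j ≠ 0 → t < |b j|) :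
    sortedL1 lam (b + t • fun j => -Real.sign (b j)) ≤
      sortedL1 lam b - t * weightSum lam (coordSupport b).card := by
  set c := b + t • fun j => -Real.sign (b j) with hc
  have habs : ∀ j, |c j| = |b j| - if b j ≠ 0 then t else 0 := by
    intro j
    simp only [hc, Pi.add_apply, Pi.smul_apply, smul_eq_mul]
    rcases lt_trichotomy (b j) 0 with h | h | h
    · have := htb j h.ne
      rw [abs_of_neg h] at this
      rw [Real.sign_of_neg h, abs_of_neg h, if_pos h.ne, abs_of_neg] <;> linarith
    · simp [h]
    · have := htb j h.ne'
      rw [abs_of_pos h] at this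
      rw [Real.sign_of_pos h, abs_of_pos h, if_pos h.ne', abs_of_pos] <;> linarith
  have hsupp : ∀ j, c j ≠ 0 ↔ b j ≠ 0 := by
    intro j
    rw [← abs_pos, habs]
    by_cases h : b j = 0
    · simp [h]
    · simp [h, htb j h]
  have hcs : coordSupport c = coordSupport b := by
    ext j
    simp only [mem_coordSupport, hsupp]
  have key : sortedL1 lam c = ∑ k, lam k * |b (Tuple.sort (fun i => -|c i|) k)|
      - t * weightSum lam (coordSupport b).card := by
    simp only [sortedL1, weightSum, Finset.mul_sum, ← Finset.sum_sub_distrib]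
    refine Finset.sum_congr rfl fun k _ => ?_
    have hk : b (Tuple.sort (fun i => -|c i|) k) ≠ 0 ↔ (k : ℕ) < (coordSupport b).card := by
      rw [← hcs, ← sortedAbs_ne_zero_iff, ← hsupp, sortedAbs, ne_eq, ne_eq, abs_eq_zero]
    rw [sortedAbs, habs]
    simp only [hk]
    split_ifs <;> ring
  rw [key]
  linarith [sum_mul_comp_perm_le_sortedL1 hlam b (Tuple.sort (fun i => -|c i|))]

theorem weightSum_le_inner_residual_sign {p : ℕ} {lam : Fin p → ℝ} (hlam : Antitone lam)
    {w b : Fin p → ℝ} (hb : ∀ c, proxObjective lam w b ≤ proxObjective lam w c) :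
    weightSum lam (coordSupport b).card ≤ ∑ i, (w i - b i) * Real.sign (b i) := by
  rw [← sub_nonneg]
  refine nonneg_of_eventually_quadratic
    (c := (1 / 2) * ∑ i, (-Real.sign (b i)) ^ 2) ?_
  have hev : ∀ᶠ t in nhdsWithin (0 : ℝ) (Set.Ioi 0), ∀ j, b j ≠ 0 → t < |b j| := by
    rw [Filter.eventually_all]
    intro j
    by_cases h : b j = 0
    · simp [h]
    · filter_upwards [nhdsWithin_le_nhds (Iio_mem_nhds (abs_pos.2 h))] with t ht _ using ht
  filter_upwards [self_mem_nhdsWithin, hev] with t (ht : 0 < t) htb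
  have h1 := hb (b + t • fun j => -Real.sign (b j))
  simp only [proxObjective, sum_sq_sub_add_smul] at h1
  have h2 := sortedL1_shrink_le hlam b htb
  simp only [mul_neg, Finset.sum_neg_distrib] at h1
  linarith

/-! ### The support as least maximizer of the score -/

theorem score_le_sum_abs {p : ℕ} {lam : Fin p → ℝ} (hlam : Antitone lam)
    (h0 : ∀ i, 0 ≤ lam i) {w b : Fin p → ℝ}
    (hb : ∀ c, proxObjective lam w b ≤ proxObjective lam w c) (A : Finset (Fin p)) :
    score lam w A ≤ ∑ j ∈ A, |b j| := by
  -- The sign pattern of `w` on `A`, with value `1` where `w j = 0` so that the support is exactly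
  -- `A`.
  set c : Fin p → ℝ := fun j => if j ∈ A then (if 0 ≤ w j then 1 else -1) else 0 with hc
  have hcs : coordSupport c = A := by
    ext j
    simp only [mem_coordSupport, hc]
    split_ifs <;> simp_all
  have h1 := inner_residual_le_sortedL1 hlam h0 hb c
  rw [sortedL1_eq_weightSum lam c, hcs] at h1
  · have h2 : ∑ j ∈ A, |w j| - ∑ j ∈ A, |b j| ≤ ∑ i, (w i - b i) * c i := by
      rw [← Finset.sum_sub_distrib, ← Finset.sum_subset (Finset.subset_univ A)]
      · refine Finset.sum_le_sum fun j hj => ?_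
        simp only [hc, if_pos hj]
        split_ifs with h
        · rw [abs_of_nonneg h]
          linarith [le_abs_self (b j)]
        · rw [abs_of_neg (not_le.1 h)]
          linarith [neg_abs_le (b j)]
      · intro j _ hj
        simp [hc, hj]
    unfold score
    linarith
  · intro j hj
    simp only [hc] at hj ⊢
    split_ifs <;> simp_all

theorem sum_abs_le_score_coordSupport {p : ℕ} {lam : Fin p → ℝ} (hlam : Antitone lam)
    {w b : Fin p → ℝ} (hb : ∀ c, proxObjective lam w b ≤ proxObjective lam w c) :
    ∑ j, |b j| ≤ score lam w (coordSupport b) := by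
  have h1 := weightSum_le_inner_residual_sign hlam hb
  have h2 : ∑ i, (w i - b i) * Real.sign (b i) ≤ ∑ j ∈ coordSupport b, |w j| - ∑ j, |b j| := by
    rw [coordSupport, Finset.sum_filter, ← Finset.sum_sub_distrib]
    refine Finset.sum_le_sum fun j _ => ?_
    rcases lt_trichotomy (b j) 0 with h | h | h
    · rw [Real.sign_of_neg h, abs_of_neg h, if_pos h.ne]
      linarith [neg_abs_le (w j)]
    · simp [h]
    · rw [Real.sign_of_pos h, abs_of_pos h, if_pos h.ne']
      linarith [le_abs_self (w j)]
  unfold score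
  linarith

theorem isLeastMaximizer_coordSupport {p : ℕ} {lam : Fin p → ℝ} (hlam : Antitone lam)
    (h0 : ∀ i, 0 ≤ lam i) {w b : Fin p → ℝ}
    (hb : ∀ c, proxObjective lam w b ≤ proxObjective lam w c) :
    IsLeastMaximizer lam w (coordSupport b) := by
  intro A
  have h1 := score_le_sum_abs hlam h0 hb A
  have h2 := sum_abs_le_score_coordSupport hlam hb
  have h3 : ∑ j ∈ A, |b j| ≤ ∑ j, |b j| :=
    Finset.sum_le_sum_of_subset_of_nonneg (Finset.subset_univ A) fun j _ _ => abs_nonneg _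
  refine ⟨by linarith, fun heq i hi => ?_⟩
  by_contra hiA
  have h4 : ∑ j ∈ A, |b j| < ∑ j, |b j| :=
    Finset.sum_lt_sum_of_subset (Finset.subset_univ A) (Finset.mem_univ i) hiA
      (abs_pos.2 (mem_coordSupport.1 hi)) fun j _ _ => abs_nonneg _
  linarith

theorem IsLeastMaximizer.unique {p : ℕ} {lam w : Fin p → ℝ} {S T : Finset (Fin p)}
    (hS : IsLeastMaximizer lam w S) (hT : IsLeastMaximizer lam w T) : S = T := by
  have h := le_antisymm (hT S).1 (hS T).1
  exact ((hS T).2 h.symm).antisymm ((hT S).2 h)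

/-- Removing `i` changes the score by `lam k - |w i|`, and it cannot tie because a tying set would
have to contain `S`. Indices start at `0`, so `lam k` is the last weight charged to `S`. -/
theorem IsLeastMaximizer.lt_abs {p : ℕ} {lam w : Fin p → ℝ} {S : Finset (Fin p)}
    (hS : IsLeastMaximizer lam w S) {i : Fin p} (hi : i ∈ S) {k : Fin p}
    (hk : (k : ℕ) + 1 = S.card) : lam k < |w i| := by
  have hne : score lam w (S.erase i) ≠ score lam w S := fun h =>
    Finset.notMem_erase i S ((hS _).2 h hi)
  have hlt := lt_of_le_of_ne (hS (S.erase i)).1 hne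
  have hcard : (S.erase i).card = k := by
    rw [Finset.card_erase_of_mem hi]
    omega
  have hsum := Finset.sum_erase_add S (fun j => |w j|) hi
  have hw : weightSum lam S.card = weightSum lam k + lam k := by
    have : lam k = ∑ j : Fin p, if j = k then lam j else 0 := by simp
    rw [this, weightSum, weightSum, ← Finset.sum_add_distrib]
    refine Finset.sum_congr rfl fun j _ => ?_
    rw [← hk]
    rcases lt_trichotomy j k with h | h | h
    · have : (j : ℕ) < k := h
      simp [this, h.ne, this.trans (Nat.lt_succ_self _)]
    · simp [h]
    · have : (k : ℕ) < j := h
      have h1 : ¬ (j : ℕ) < k + 1 := by omega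
      have h2 : ¬ (j : ℕ) < k := by omega
      simp [h1, h2, h.ne']
  simp only [score, hcard, hw] at hlt
  linarith

/-! ### Reduction to the proximal problem -/

theorem transpose_mul_self {n p : ℕ} {X : Matrix (Fin n) (Fin p) ℝ}
    (hX : IsOrthogonalDesign X) : X.transpose * X = 1 := by
  ext i k
  rw [Matrix.mul_apply, Matrix.one_apply]
  simp only [Matrix.transpose_apply]
  split_ifs with h
  · subst h
    rw [← hX.1 i]
    exact Finset.sum_congr rfl fun j _ => (sq _).symm
  · exact hX.2 i k h

theorem objective_eq_proxObjective_add {n p : ℕ} {X : Matrix (Fin n) (Fin p) ℝ}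
    (hX : IsOrthogonalDesign X) (lam : Fin p → ℝ) (y : Fin n → ℝ) (b : Fin p → ℝ) :
    objective X lam y b = proxObjective lam (X.transpose.mulVec y) b +
      (1 / 2) * (∑ j, y j ^ 2 - ∑ i, X.transpose.mulVec y i ^ 2) := by
  have h1 : ∑ j, X.mulVec b j ^ 2 = ∑ i, b i ^ 2 := by
    have : X.mulVec b ⬝ᵥ X.mulVec b = b ⬝ᵥ b := by
      rw [Matrix.dotProduct_mulVec, ← Matrix.mulVec_transpose, Matrix.mulVec_mulVec, transpose_mul_self hX,
        Matrix.one_mulVec]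
    simpa [dotProduct, sq] using this
  have h2 : ∑ j, y j * X.mulVec b j = ∑ i, X.transpose.mulVec y i * b i := by
    have : y ⬝ᵥ X.mulVec b = X.transpose.mulVec y ⬝ᵥ b := by
      rw [Matrix.dotProduct_mulVec, ← Matrix.mulVec_transpose]
    simpa [dotProduct] using this
  have h3 : ∀ (m : ℕ) (u v : Fin m → ℝ), ∑ j, (u j - v j) ^ 2 =
      ∑ j, u j ^ 2 - 2 * ∑ j, u j * v j + ∑ j, v j ^ 2 := by
    intro m u v
    simp only [Finset.mul_sum, ← Finset.sum_sub_distrib, ← Finset.sum_add_distrib]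
    exact Finset.sum_congr rfl fun j _ => by ring
  rw [objective, proxObjective, h3, h3, h1, h2]
  ring

theorem isEstimate_iff {n p : ℕ} {X : Matrix (Fin n) (Fin p) ℝ}
    (hX : IsOrthogonalDesign X) (lam : Fin p → ℝ) (y : Fin n → ℝ) (b : Fin p → ℝ) :
    IsEstimate X lam y b ↔ ∀ c, proxObjective lam (X.transpose.mulVec y) b ≤
      proxObjective lam (X.transpose.mulVec y) c := by
  simp only [IsEstimate, objective_eq_proxObjective_add hX, add_le_add_iff_right]

/-! ### Existence and uniqueness of the minimizer -/

theorem continuous_sortedL1 {p : ℕ} {lam : Fin p → ℝ} (hlam : Antitone lam)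
    (h0 : ∀ i, 0 ≤ lam i) : Continuous (sortedL1 lam) := by
  have hK : 0 ≤ ∑ i, lam i := Finset.sum_nonneg fun i _ => h0 i
  refine (LipschitzWith.of_le_add_mul ⟨_, hK⟩ fun b c => ?_).continuous
  have h1 := sortedL1_add_le hlam h0 c (b - c)
  rw [add_sub_cancel] at h1
  have h2 := sortedL1_le_mul_norm h0 (b - c)
  rw [dist_eq_norm]
  exact h1.trans (add_le_add_right h2 _)

theorem existsUnique_proxObjective_min {p : ℕ} {lam : Fin p → ℝ} (hlam : Antitone lam)
    (h0 : ∀ i, 0 ≤ lam i) (w : Fin p → ℝ) :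
    ∃! b, ∀ c, proxObjective lam w b ≤ proxObjective lam w c := by
  refine existsUnique_of_exists_of_unique ?_ ?_
  · have hcont : Continuous (proxObjective lam w) := by
      have := continuous_sortedL1 hlam h0
      unfold proxObjective
      fun_prop
    refine hcont.exists_forall_le' 0 ?_
    have hsq : ∀ b : Fin p → ℝ, ‖w - b‖ ^ 2 ≤ ∑ i, (w i - b i) ^ 2 := by
      intro b
      have hs : 0 ≤ ∑ i, (w i - b i) ^ 2 := Finset.sum_nonneg fun i _ => sq_nonneg _
      rw [← Real.le_sqrt (norm_nonneg _) hs, pi_norm_le_iff_of_nonneg (Real.sqrt_nonneg _)]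
      intro i
      rw [Real.norm_eq_abs]
      refine Real.abs_le_sqrt ?_
      exact Finset.single_le_sum (f := fun i => (w i - b i) ^ 2) (fun i _ => sq_nonneg _)
        (Finset.mem_univ i)
    have hF0 : 0 ≤ proxObjective lam w 0 := by
      have h1 := sortedL1_nonneg h0 (0 : Fin p → ℝ)
      have h2 : 0 ≤ ∑ i, (w i - (0 : Fin p → ℝ) i) ^ 2 := Finset.sum_nonneg fun i _ => sq_nonneg _
      unfold proxObjective
      linarith
    -- Coercivity: beyond this radius the quadratic term alone exceeds the value at `0`.
    filter_upwards [(tendsto_norm_cocompact_atTop (E := Fin p → ℝ)).eventually_ge_atTop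
      (‖w‖ + Real.sqrt (2 * proxObjective lam w 0))] with b hb
    have h1 : Real.sqrt (2 * proxObjective lam w 0) ≤ ‖w - b‖ := by
      have := norm_sub_norm_le b w
      rw [norm_sub_rev] at this
      linarith
    have h2 := (Real.sqrt_le_left (norm_nonneg _)).1 h1
    have h3 := hsq b
    have h4 := sortedL1_nonneg h0 b
    conv_rhs => unfold proxObjective
    linarith
  · intro b c hb hc
    have hbc : proxObjective lam w b = proxObjective lam w c := le_antisymm (hb c) (hc b)
    -- Strict convexity: the midpoint of two minimizers would gain an eighth of their squared
    -- distance.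
    have hm := hb ((1 / 2 : ℝ) • b + (1 / 2 : ℝ) • c)
    have h1 := sortedL1_add_le hlam h0 ((1 / 2 : ℝ) • b) ((1 / 2 : ℝ) • c)
    have h2 := sortedL1_smul_le hlam b (t := 1 / 2) (by norm_num)
    have h3 := sortedL1_smul_le hlam c (t := 1 / 2) (by norm_num)
    have h4 : ∑ i, (w i - ((1 / 2 : ℝ) • b + (1 / 2 : ℝ) • c) i) ^ 2 =
        (1 / 2) * ∑ i, (w i - b i) ^ 2 + (1 / 2) * ∑ i, (w i - c i) ^ 2 -
          (1 / 4) * ∑ i, (b i - c i) ^ 2 := by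
      simp only [Finset.mul_sum, ← Finset.sum_sub_distrib, ← Finset.sum_add_distrib]
      refine Finset.sum_congr rfl fun i _ => ?_
      simp only [Pi.add_apply, Pi.smul_apply, smul_eq_mul]
      ring
    have h5 : ∑ i, (b i - c i) ^ 2 ≤ 0 := by
      unfold proxObjective at hbc hm
      rw [h4] at hm
      linarith
    have h6 := (Finset.sum_eq_zero_iff_of_nonneg fun i _ => sq_nonneg (b i - c i)).1
      (le_antisymm h5 (Finset.sum_nonneg fun i _ => sq_nonneg _))
    funext i
    have := h6 i (Finset.mem_univ i)
    exact sub_eq_zero.1 (pow_eq_zero_iff two_ne_zero |>.1 this)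

/-! ### Normal quantiles and the tail bound for the weights -/

theorem gaussianReal_Iic_neg (x : ℝ) :
    (gaussianReal 0 1).real (Set.Iic (-x)) = (gaussianReal 0 1).real (Set.Ici x) := by
  have h : (gaussianReal 0 1).map (fun x : ℝ => -x) = gaussianReal 0 1 := by
    simpa using gaussianReal_map_neg (μ := 0) (v := 1)
  conv_rhs => rw [← h]
  rw [map_measureReal_apply (by fun_prop) measurableSet_Ici]
  congr 1
  ext y
  simp only [Set.mem_Iic, Set.mem_preimage, Set.mem_Ici]
  constructor <;> intro h <;> linarith

theorem cdf_gaussianReal_lt_half {x : ℝ} (hx : x < 0) : cdf (gaussianReal 0 1) x < 1 / 2 := by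
  rw [cdf_eq_real]
  have hsymm := gaussianReal_Iic_neg (-x)
  rw [neg_neg] at hsymm
  have hpos : 0 < (gaussianReal 0 1).real (Set.Ioo x (-x)) := by
    refine ENNReal.toReal_pos (fun h => ?_) (measure_ne_top _ _)
    have := gaussianReal_absolutelyContinuous' 0 (v := 1) one_ne_zero h
    rw [Real.volume_Ioo, ENNReal.ofReal_eq_zero] at this
    linarith
  have h1 : (gaussianReal 0 1).real (Set.Iic x ∪ Set.Ioo x (-x)) =
      (gaussianReal 0 1).real (Set.Iic x) + (gaussianReal 0 1).real (Set.Ioo x (-x)) :=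
    measureReal_union (Set.disjoint_left.2 fun y hy hy' => not_lt.2 hy hy'.1) measurableSet_Ioo
  have h2 : (gaussianReal 0 1).real ((Set.Iic x ∪ Set.Ioo x (-x)) ∪ Set.Ici (-x)) =
      (gaussianReal 0 1).real (Set.Iic x ∪ Set.Ioo x (-x)) +
        (gaussianReal 0 1).real (Set.Ici (-x)) := by
    refine measureReal_union (Set.disjoint_left.2 ?_) measurableSet_Ici
    rintro y (hy | hy) (hy' : -x ≤ y)
    · have : y ≤ x := hy
      linarith
    · exact not_lt.2 hy' hy.2
  have h3 := measureReal_le_one (μ := gaussianReal 0 1)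
    (s := (Set.Iic x ∪ Set.Ioo x (-x)) ∪ Set.Ici (-x))
  linarith

theorem nonneg_of_half_le_cdf {α x : ℝ} (hα : 1 / 2 ≤ α) (hx : α ≤ cdf (gaussianReal 0 1) x) :
    0 ≤ x := by
  by_contra h
  linarith [cdf_gaussianReal_lt_half (not_le.1 h)]

theorem normalQuantile_nonneg {α : ℝ} (hα : 1 / 2 ≤ α) : 0 ≤ normalQuantile α :=
  Real.sInf_nonneg fun _ hx => nonneg_of_half_le_cdf hα hx

theorem exists_le_cdf {α : ℝ} (hα : α < 1) : ∃ x, α ≤ cdf (gaussianReal 0 1) x :=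
  ((tendsto_cdf_atTop (gaussianReal 0 1)).eventually_const_le hα).exists

theorem normalQuantile_mono {α α' : ℝ} (hα : 1 / 2 ≤ α) (h : α ≤ α') (hα' : α' < 1) :
    normalQuantile α ≤ normalQuantile α' :=
  csInf_le_csInf ⟨0, fun _ hx => nonneg_of_half_le_cdf hα hx⟩ (exists_le_cdf hα')
    fun _ hx => h.trans hx

/-- The infimum is attained by right continuity of the distribution function. -/
theorem le_cdf_normalQuantile {α : ℝ} (hα : α < 1) :
    α ≤ cdf (gaussianReal 0 1) (normalQuantile α) := by
  have hc := ((cdf (gaussianReal 0 1)).right_continuous (normalQuantile α)).mono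
    Set.Ioi_subset_Ici_self
  refine ge_of_tendsto hc ?_
  filter_upwards [self_mem_nhdsWithin] with x hx
  obtain ⟨y, hy, hyx⟩ := exists_lt_of_csInf_lt (exists_le_cdf hα) hx
  exact le_trans hy (monotone_cdf _ hyx.le)

theorem measureReal_normalQuantile_lt_abs_le {α : ℝ} (hα : α < 1) :
    (gaussianReal 0 1).real {x | normalQuantile α < |x|} ≤ 2 * (1 - α) := by
  set t := normalQuantile α with ht
  have h1 : (gaussianReal 0 1).real (Set.Ioi t) ≤ 1 - α := by
    rw [← Set.compl_Iic, probReal_compl_eq_one_sub measurableSet_Iic, ← cdf_eq_real]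
    linarith [le_cdf_normalQuantile hα]
  have h : (gaussianReal 0 1).map (fun x : ℝ => -x) = gaussianReal 0 1 := by
    simpa using gaussianReal_map_neg (μ := 0) (v := 1)
  have h2 : (gaussianReal 0 1).real ((fun x : ℝ => -x) ⁻¹' Set.Ioi t) =
      (gaussianReal 0 1).real (Set.Ioi t) := by
    conv_rhs => rw [← h]
    rw [map_measureReal_apply (by fun_prop) measurableSet_Ioi]
  have h3 : {x : ℝ | t < |x|} = Set.Ioi t ∪ (fun x : ℝ => -x) ⁻¹' Set.Ioi t := by
    ext x
    change t < |x| ↔ t < x ∨ t < -x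
    exact lt_abs
  rw [h3]
  refine (measureReal_union_le _ _).trans ?_
  linarith

section Weights

variable {p : ℕ} {q : ℝ}

theorem quantileLevel_lt_one (hq0 : 0 < q) (i : Fin p) :
    1 - ((i : ℝ) + 1) * q / (2 * (p : ℝ)) < 1 := by
  have : 0 < p := i.pos
  have : 0 < ((i : ℝ) + 1) * q / (2 * (p : ℝ)) := by positivity
  linarith

theorem half_le_quantileLevel (hq0 : 0 < q) (hq1 : q ≤ 1) (i : Fin p) :
    1 / 2 ≤ 1 - ((i : ℝ) + 1) * q / (2 * (p : ℝ)) := by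
  have hp : (0 : ℝ) < p := Nat.cast_pos.2 i.pos
  have hi : (i : ℝ) + 1 ≤ p := by exact_mod_cast i.isLt
  have : ((i : ℝ) + 1) * q / (2 * (p : ℝ)) ≤ 1 / 2 := by
    rw [div_le_div_iff₀ (by positivity) two_pos]
    nlinarith [mul_le_mul hi hq1 hq0.le hp.le]
  linarith

theorem lambdaBH_nonneg (hq0 : 0 < q) (hq1 : q ≤ 1) (i : Fin p) : 0 ≤ lambdaBH p q i :=
  normalQuantile_nonneg (half_le_quantileLevel hq0 hq1 i)

theorem lambdaBH_antitone (hq0 : 0 < q) (hq1 : q ≤ 1) : Antitone (lambdaBH p q) := by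
  intro i j hij
  refine normalQuantile_mono (half_le_quantileLevel hq0 hq1 j) ?_ (quantileLevel_lt_one hq0 i)
  have : (i : ℝ) ≤ j := by exact_mod_cast hij
  gcongr

theorem measureReal_lambdaBH_lt_abs_le (hq0 : 0 < q) (i : Fin p) :
    (gaussianReal 0 1).real {x | lambdaBH p q i < |x|} ≤ ((i : ℝ) + 1) * (q / p) := by
  refine (measureReal_normalQuantile_lt_abs_le (quantileLevel_lt_one hq0 i)).trans_eq ?_
  have hp : (p : ℝ) ≠ 0 := Nat.cast_ne_zero.2 i.pos.ne'
  field_simp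
  ring

end Weights

/-! ### Events that ignore one coordinate -/

/-- The vectors for which the least cardinality of a set of maximal score, among the index sets
containing `i`, is `r`. -/
def leastCardEvent {p : ℕ} (lam : Fin p → ℝ) (i : Fin p) (r : ℕ) : Set (Fin p → ℝ) :=
  {v | ∃ A, i ∈ A ∧ A.card = r ∧ ∀ A', i ∈ A' →
    score lam v A' ≤ score lam v A ∧ (score lam v A' = score lam v A → r ≤ A'.card)}

theorem measurable_score {p : ℕ} (lam : Fin p → ℝ) (A : Finset (Fin p)) :
    Measurable fun v => score lam v A := by
  unfold score
  fun_prop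

theorem measurableSet_leastCardEvent {p : ℕ} (lam : Fin p → ℝ) (i : Fin p) (r : ℕ) :
    MeasurableSet (leastCardEvent lam i r) := by
  have hm := measurable_score lam
  unfold leastCardEvent
  rw [Set.ofPred_exists]
  refine MeasurableSet.iUnion fun A => ?_
  refine (MeasurableSet.const _).inter ((MeasurableSet.const _).inter ?_)
  change MeasurableSet {v : Fin p → ℝ | ∀ A', i ∈ A' →
    score lam v A' ≤ score lam v A ∧ (score lam v A' = score lam v A → r ≤ A'.card)}
  simp only [Set.ofPred_forall]
  refine MeasurableSet.iInter fun A' => MeasurableSet.iInter fun _ => ?_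
  refine (measurableSet_le (hm A') (hm A)).inter ?_
  exact (measurableSet_eq_fun (hm A') (hm A)).imp (MeasurableSet.const _)

theorem disjoint_leastCardEvent {p : ℕ} (lam : Fin p → ℝ) (i : Fin p) {r s : ℕ} (hrs : r ≠ s) :
    Disjoint (leastCardEvent lam i r) (leastCardEvent lam i s) := by
  refine Set.disjoint_left.2 ?_
  rintro v ⟨A, hiA, hA, h⟩ ⟨B, hiB, hB, h'⟩
  have heq := le_antisymm (h' A hiA).1 (h B hiB).1
  refine hrs (le_antisymm ?_ ?_)
  · rw [← hB]
    exact (h B hiB).2 heq.symm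
  · rw [← hA]
    exact (h' A hiA).2 heq

theorem score_update {p : ℕ} (lam w : Fin p → ℝ) {i : Fin p} {A : Finset (Fin p)} (hi : i ∈ A) :
    score lam (Function.update w i 0) A = score lam w A - |w i| := by
  have h : ∑ j ∈ A.erase i, |Function.update w i 0 j| = ∑ j ∈ A.erase i, |w j| :=
    Finset.sum_congr rfl fun j hj => by rw [Function.update_of_ne (Finset.ne_of_mem_erase hj)]
  rw [score, score, ← Finset.sum_erase_add A _ hi, ← Finset.sum_erase_add A (fun j => |w j|) hi, h]
  simp
  ring

/-- Zeroing `w i` subtracts `|w i|` from the score of every set containing `i`, so comparisons among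
those sets are unchanged. -/
theorem IsLeastMaximizer.update_mem_leastCardEvent {p : ℕ} {lam w : Fin p → ℝ}
    {S : Finset (Fin p)} (hS : IsLeastMaximizer lam w S) {i : Fin p} (hi : i ∈ S) :
    Function.update w i 0 ∈ leastCardEvent lam i S.card := by
  refine ⟨S, hi, rfl, fun A hA => ?_⟩
  rw [score_update lam w hi, score_update lam w hA]
  exact ⟨sub_le_sub_right (hS A).1 _,
    fun h => Finset.card_le_card ((hS A).2 (sub_left_injective h))⟩

theorem measurableSet_isLeastMaximizer {p : ℕ} (lam : Fin p → ℝ) (S : Finset (Fin p)) :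
    MeasurableSet {w | IsLeastMaximizer lam w S} := by
  have hm := measurable_score lam
  simp only [IsLeastMaximizer, Set.ofPred_forall]
  refine MeasurableSet.iInter fun A => (measurableSet_le (hm A) (hm S)).inter ?_
  exact (measurableSet_eq_fun (hm A) (hm S)).imp (MeasurableSet.const _)

/-! ### Bounding the expected false discovery proportion -/

/-- The false discovery proportion as a function of the sufficient statistic. -/
def discoveryProportion {p : ℕ} (lam β w : Fin p → ℝ) : ℝ :=
  ∑ S : Finset (Fin p), Set.indicator {w | IsLeastMaximizer lam w S}
    (fun _ => ((Finset.univ.filter fun i => β i = 0 ∧ i ∈ S).card : ℝ) / max (S.card : ℝ) 1) w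

theorem IsLeastMaximizer.discoveryProportion_eq {p : ℕ} {lam w : Fin p → ℝ}
    {S : Finset (Fin p)} (hS : IsLeastMaximizer lam w S) (β : Fin p → ℝ) :
    discoveryProportion lam β w =
      ((Finset.univ.filter fun i => β i = 0 ∧ i ∈ S).card : ℝ) / max (S.card : ℝ) 1 := by
  rw [discoveryProportion, Finset.sum_eq_single S]
  · rw [Set.indicator_of_mem (by exact hS)]
  · intro T _ hT
    exact Set.indicator_of_notMem (fun h : IsLeastMaximizer lam w T => hT (h.unique hS)) _
  · simp

theorem measurable_discoveryProportion {p : ℕ} (lam β : Fin p → ℝ) :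
    Measurable (discoveryProportion lam β) := by
  unfold discoveryProportion
  exact Finset.measurable_fun_sum _ fun S _ =>
    measurable_const.indicator (measurableSet_isLeastMaximizer lam S)

theorem integrable_discoveryProportion {p : ℕ} (lam β : Fin p → ℝ) (μ : Measure (Fin p → ℝ))
    [IsFiniteMeasure μ] : Integrable (discoveryProportion lam β) μ := by
  unfold discoveryProportion
  exact integrable_finsetSum _ fun S _ =>
    (integrable_const _).indicator (measurableSet_isLeastMaximizer lam S)

/-- The event that the `i`th magnitude exceeds the `k`th weight while the least cardinality of a
best set containing `i` is `k + 1`. -/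
def exceedEvent {p : ℕ} (lam : Fin p → ℝ) (i k : Fin p) : Set (Fin p → ℝ) :=
  {w | lam k < |w i|} ∩ {w | Function.update w i 0 ∈ leastCardEvent lam i (k + 1)}

theorem measurable_update_zero {p : ℕ} (i : Fin p) :
    Measurable fun w : Fin p → ℝ => Function.update w i 0 := by
  refine measurable_pi_lambda _ fun j => ?_
  by_cases h : j = i
  · subst h
    simp
  · simpa [Function.update_of_ne h] using measurable_pi_apply j

theorem measurableSet_update_mem {p : ℕ} (lam : Fin p → ℝ) (i : Fin p) (r : ℕ) :
    MeasurableSet {w : Fin p → ℝ | Function.update w i 0 ∈ leastCardEvent lam i r} :=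
  measurable_update_zero i (measurableSet_leastCardEvent lam i r)

theorem measurableSet_exceedEvent {p : ℕ} (lam : Fin p → ℝ) (i k : Fin p) :
    MeasurableSet (exceedEvent lam i k) :=
  (measurableSet_lt measurable_const (by fun_prop)).inter (measurableSet_update_mem lam i _)

theorem IsLeastMaximizer.discoveryProportion_le {p : ℕ} {lam w : Fin p → ℝ}
    {S : Finset (Fin p)} (hS : IsLeastMaximizer lam w S) (β : Fin p → ℝ) :
    discoveryProportion lam β w ≤ ∑ i with β i = 0, ∑ k : Fin p,
      (exceedEvent lam i k).indicator (fun _ => ((k : ℝ) + 1)⁻¹) w := by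
  have hnn : ∀ i k : Fin p, 0 ≤ (exceedEvent lam i k).indicator (fun _ => ((k : ℝ) + 1)⁻¹) w :=
    fun i k => Set.indicator_nonneg (fun _ _ => by positivity) w
  rw [hS.discoveryProportion_eq, ← Finset.filter_filter, Finset.card_filter, Nat.cast_sum,
    Finset.sum_div]
  refine Finset.sum_le_sum fun i _ => ?_
  split_ifs with hi
  · have hcard : 0 < S.card := Finset.card_pos.2 ⟨i, hi⟩
    have hle : S.card ≤ p := by simpa using Finset.card_le_univ S
    -- Zero-based, so `k + 1 = |S|` and the single term at `k` already equals `1 / |S|`.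
    set k : Fin p := ⟨S.card - 1, by omega⟩ with hk
    have hk1 : (k : ℕ) + 1 = S.card := by simp [hk]; omega
    have hkR : (k : ℝ) + 1 = S.card := by exact_mod_cast hk1
    have hmem : w ∈ exceedEvent lam i k := by
      refine ⟨hS.lt_abs hi hk1, ?_⟩
      rw [hk1]
      exact hS.update_mem_leastCardEvent hi
    refine le_trans ?_ (Finset.single_le_sum (fun k _ => hnn i k) (Finset.mem_univ k))
    rw [Set.indicator_of_mem hmem, hkR, max_eq_left (by exact_mod_cast hcard)]
    simp
  · simpa using Finset.sum_nonneg fun k _ => hnn i k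

/-- The first event depends on coordinate `i` only, the second on the others only. -/
theorem measureReal_exceedEvent {p : ℕ} (lam : Fin p → ℝ) (ν : Fin p → Measure ℝ)
    [∀ i, IsProbabilityMeasure (ν i)] (i k : Fin p) :
    (Measure.pi ν).real (exceedEvent lam i k) = (ν i).real {x | lam k < |x|} *
      (Measure.pi ν).real {w | Function.update w i 0 ∈ leastCardEvent lam i (k + 1)} := by
  have hind : iIndepFun (fun j (w : Fin p → ℝ) => w j) (Measure.pi ν) :=
    iIndepFun_pi (X := fun _ x => x) fun _ => aemeasurable_id
  have h1 := hind.indepFun_finset {i} (Finset.univ.erase i)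
    (by simp) fun j => measurable_pi_apply j
  let φ : (↥({i} : Finset (Fin p)) → ℝ) → ℝ := fun g => g ⟨i, by simp⟩
  let ψ : (↥(Finset.univ.erase i) → ℝ) → Fin p → ℝ := fun g j =>
    if h : j = i then 0 else g ⟨j, by simp [h]⟩
  have hφ : Measurable φ := measurable_pi_apply _
  have hψ : Measurable ψ := by
    refine measurable_pi_lambda _ fun j => ?_
    by_cases h : j = i
    · simp [ψ, h]
    · simpa [ψ, h] using measurable_pi_apply _
  have h3 := (h1.comp hφ hψ).measure_inter_preimage_eq_mul {x | lam k < |x|}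
    (leastCardEvent lam i (k + 1)) (measurableSet_lt measurable_const (by fun_prop))
    (measurableSet_leastCardEvent lam i _)
  have h4 : (ψ ∘ fun (a : Fin p → ℝ) j => a j) = fun w => Function.update w i 0 := by
    funext w j
    by_cases h : j = i
    · subst h
      simp [ψ]
    · simp [ψ, h]
  rw [h4] at h3
  have h5 : (ν i) {x | lam k < |x|} = (Measure.pi ν) {w | lam k < |w i|} := by
    rw [← (measurePreserving_eval ν i).measure_preimage
      (measurableSet_lt measurable_const (by fun_prop)).nullMeasurableSet]
    rfl
  rw [measureReal_def, measureReal_def, measureReal_def, h5, ← ENNReal.toReal_mul]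
  exact congrArg ENNReal.toReal h3

theorem sum_measureReal_update_mem_le_one {p : ℕ} (lam : Fin p → ℝ)
    (μ : Measure (Fin p → ℝ)) [IsProbabilityMeasure μ] (i : Fin p) :
    ∑ k : Fin p, μ.real {w | Function.update w i 0 ∈ leastCardEvent lam i (k + 1)} ≤ 1 := by
  rw [← measureReal_iUnion_fintype]
  · exact measureReal_le_one
  · intro k l hkl
    refine Set.disjoint_left.2 fun w hw hw' => ?_
    exact Set.disjoint_left.1 (disjoint_leastCardEvent lam i
      (fun h => hkl (Fin.ext (Nat.succ_injective h)))) hw hw'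
  · exact fun k => measurableSet_update_mem lam i _

theorem integral_discoveryProportion_le {p : ℕ} {q : ℝ} (hq0 : 0 < q) (hq1 : q ≤ 1)
    (β : Fin p → ℝ) (ν : Fin p → Measure ℝ) [∀ i, IsProbabilityMeasure (ν i)]
    (hν : ∀ i, β i = 0 → ν i = gaussianReal 0 1) :
    ∫ w, discoveryProportion (lambdaBH p q) β w ∂(Measure.pi ν) ≤ q * numNulls β / p := by
  set lam := lambdaBH p q with hlam
  have hint : ∀ i k : Fin p, Integrable
      ((exceedEvent lam i k).indicator fun _ => ((k : ℝ) + 1)⁻¹) (Measure.pi ν) := fun i k =>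
    (integrable_const _).indicator (measurableSet_exceedEvent lam i k)
  have hmono : ∫ w, discoveryProportion lam β w ∂(Measure.pi ν) ≤
      ∫ w, ∑ i with β i = 0, ∑ k : Fin p,
        (exceedEvent lam i k).indicator (fun _ => ((k : ℝ) + 1)⁻¹) w ∂(Measure.pi ν) := by
    refine integral_mono (integrable_discoveryProportion lam β _)
      (integrable_finsetSum _ fun i _ => integrable_finsetSum _ fun k _ => hint i k) fun w => ?_
    -- The proximal minimizer supplies a least maximizer at every `w`.
    obtain ⟨b, hb, -⟩ := existsUnique_proxObjective_min (lambdaBH_antitone hq0 hq1)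
      (lambdaBH_nonneg hq0 hq1) w
    exact (isLeastMaximizer_coordSupport (lambdaBH_antitone hq0 hq1)
      (lambdaBH_nonneg hq0 hq1) hb).discoveryProportion_le β
  refine hmono.trans ?_
  rw [integral_finsetSum _ fun i _ => integrable_finsetSum _ fun k _ => hint i k]
  have hbound : ∀ i, β i = 0 → ∫ w, ∑ k : Fin p,
      (exceedEvent lam i k).indicator (fun _ => ((k : ℝ) + 1)⁻¹) w ∂(Measure.pi ν) ≤ q / p := by
    intro i hi
    rw [integral_finsetSum _ fun k _ => hint i k]
    have hqp : 0 ≤ q / p := by positivity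
    calc ∑ k : Fin p, ∫ w, (exceedEvent lam i k).indicator (fun _ => ((k : ℝ) + 1)⁻¹) w
          ∂(Measure.pi ν)
        ≤ ∑ k : Fin p, q / p *
          (Measure.pi ν).real {w | Function.update w i 0 ∈ leastCardEvent lam i (k + 1)} := by
          refine Finset.sum_le_sum fun k _ => ?_
          rw [integral_indicator_const _ (measurableSet_exceedEvent lam i k), smul_eq_mul,
            measureReal_exceedEvent, hν i hi]
          have h1 := measureReal_lambdaBH_lt_abs_le hq0 k
          have hk : (0 : ℝ) < (k : ℝ) + 1 := by positivity
          set D := (Measure.pi ν).real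
            {w | Function.update w i 0 ∈ leastCardEvent lam i (k + 1)} with hD
          have hD0 : 0 ≤ D := measureReal_nonneg
          rw [← div_eq_mul_inv, div_le_iff₀ hk]
          calc _ ≤ ((k : ℝ) + 1) * (q / p) * D := mul_le_mul_of_nonneg_right h1 hD0
            _ = _ := by ring
      _ ≤ q / p * 1 := by
          rw [← Finset.mul_sum]
          exact mul_le_mul_of_nonneg_left (sum_measureReal_update_mem_le_one lam _ i) hqp
      _ = q / p := mul_one _
  refine (Finset.sum_le_sum fun i hi => hbound i (Finset.mem_filter.1 hi).2).trans_eq ?_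
  rw [Finset.sum_const, nsmul_eq_mul, numNulls]
  ring

/-! ### The law of `Xᵀy` -/

section Design

variable {Ω : Type*} [MeasurableSpace Ω] {P : Measure Ω} {n p : ℕ}
  {X : Matrix (Fin n) (Fin p) ℝ} {z : Fin n → Ω → ℝ}

theorem hasGaussianLaw_transpose_mulVec (X : Matrix (Fin n) (Fin p) ℝ)
    (hz : ∀ j, HasLaw (z j) (gaussianReal 0 1) P) (hind : iIndepFun z P) :
    HasGaussianLaw (fun ω => X.transpose.mulVec fun j => z j ω) P :=
  (hind.hasGaussianLaw fun j => (hz j).hasGaussianLaw).map_fun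
    (LinearMap.toContinuousLinearMap X.transpose.mulVecLin)

theorem covariance_transpose_mulVec [IsProbabilityMeasure P] (X : Matrix (Fin n) (Fin p) ℝ)
    (hz : ∀ j, HasLaw (z j) (gaussianReal 0 1) P) (hind : iIndepFun z P) (i k : Fin p) :
    cov[fun ω => X.transpose.mulVec (fun j => z j ω) i,
      fun ω => X.transpose.mulVec (fun j => z j ω) k; P] = ∑ j, X j i * X j k := by
  have hL2 : ∀ j, MemLp (z j) 2 P := fun j => (hz j).hasGaussianLaw.memLp_two
  have hcov : ∀ j l, cov[z j, z l; P] = if j = l then 1 else 0 := by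
    intro j l
    split_ifs with h
    · subst h
      rw [covariance_self (hz j).aemeasurable, (hz j).variance_eq, variance_id_gaussianReal]
      simp
    · exact (hind.indepFun h).covariance_eq_zero (hL2 j) (hL2 l)
  simp only [Matrix.mulVec, dotProduct, Matrix.transpose_apply]
  rw [covariance_fun_sum_fun_sum (fun j => (hL2 j).const_mul _) fun j => (hL2 j).const_mul _]
  simp only [covariance_const_mul_left, covariance_const_mul_right, hcov]
  simp [mul_comm]

theorem hasLaw_transpose_mulVec [IsProbabilityMeasure P] (hX : IsOrthogonalDesign X)
    (hz : ∀ j, HasLaw (z j) (gaussianReal 0 1) P) (hind : iIndepFun z P) (i : Fin p) :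
    HasLaw (fun ω => X.transpose.mulVec (fun j => z j ω) i) (gaussianReal 0 1) P := by
  have hG := (hasGaussianLaw_transpose_mulVec X hz hind).eval i
  refine ⟨hG.aemeasurable, ?_⟩
  rw [hG.map_eq_gaussianReal]
  have hvar : Var[fun ω => X.transpose.mulVec (fun j => z j ω) i; P] = 1 := by
    rw [← covariance_self hG.aemeasurable, covariance_transpose_mulVec X hz hind, ← hX.1 i]
    exact Finset.sum_congr rfl fun j _ => (sq _).symm
  have hmean : ∫ ω, X.transpose.mulVec (fun j => z j ω) i ∂P = 0 := by
    simp only [Matrix.mulVec, dotProduct]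
    rw [integral_finsetSum _ fun j _ => (hz j).hasGaussianLaw.integrable.const_mul _]
    refine Finset.sum_eq_zero fun j _ => ?_
    rw [integral_const_mul, (hz j).integral_eq, integral_id_gaussianReal, mul_zero]
  rw [hvar, hmean, Real.toNNReal_one]

/-- The coordinates are jointly Gaussian with covariance the Gram matrix of the design, and
uncorrelated jointly Gaussian variables are independent. -/
theorem iIndepFun_transpose_mulVec [IsProbabilityMeasure P] (hX : IsOrthogonalDesign X)
    (hz : ∀ j, HasLaw (z j) (gaussianReal 0 1) P) (hind : iIndepFun z P) :
    iIndepFun (fun i ω => X.transpose.mulVec (fun j => z j ω) i) P :=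
  (hasGaussianLaw_transpose_mulVec X hz hind).iIndepFun_of_covariance_eq_zero fun i k hik => by
    rw [covariance_transpose_mulVec X hz hind, hX.2 i k hik]

theorem transpose_mulVec_mulVec_add (hX : IsOrthogonalDesign X) (β : Fin p → ℝ)
    (e : Fin n → ℝ) (i : Fin p) :
    X.transpose.mulVec (fun j => X.mulVec β j + e j) i = β i + X.transpose.mulVec e i := by
  have : (fun j => X.mulVec β j + e j) = X.mulVec β + e := rfl
  rw [this, Matrix.mulVec_add, Matrix.mulVec_mulVec, transpose_mul_self hX, Matrix.one_mulVec,
    Pi.add_apply]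

theorem hasLaw_transpose_mulVec_response [IsProbabilityMeasure P] (hX : IsOrthogonalDesign X) (β : Fin p → ℝ)
    (hz : ∀ j, HasLaw (z j) (gaussianReal 0 1) P) (hind : iIndepFun z P) :
    HasLaw (fun ω => X.transpose.mulVec fun j => X.mulVec β j + z j ω)
      (Measure.pi fun i => gaussianReal (β i) 1) P := by
  have hlaw : ∀ i, HasLaw (fun ω => X.transpose.mulVec (fun j => X.mulVec β j + z j ω) i)
      (gaussianReal (β i) 1) P := by
    intro i
    simp only [transpose_mulVec_mulVec_add hX]
    simpa using gaussianReal_const_add (hasLaw_transpose_mulVec hX hz hind i) (β i)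
  refine iIndepFun.hasLaw_pi hlaw ?_
  simp only [transpose_mulVec_mulVec_add hX]
  exact (iIndepFun_transpose_mulVec hX hz hind).comp (fun i x => β i + x) fun i => by fun_prop

end Design

end

end SLOPE

theorem theorem1p3 {Ω : Type*} [MeasurableSpace Ω] (P : Measure Ω) [IsProbabilityMeasure P]
    (n p : ℕ) (hp : 0 < p) (q : ℝ) (hq0 : 0 < q) (hq1 : q ≤ 1)
    (X : Matrix (Fin n) (Fin p) ℝ) (hX : SLOPE.IsOrthogonalDesign X)
    (β : Fin p → ℝ) (z : Fin n → Ω → ℝ)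
    (hz : ∀ j, HasLaw (z j) (gaussianReal 0 1) P) (hind : iIndepFun z P) :
    (∀ y : Fin n → ℝ, ∃! b : Fin p → ℝ,
      SLOPE.IsEstimate X (SLOPE.lambdaBH p q) y b) ∧
    ∀ βhat : Ω → Fin p → ℝ,
      (∀ ω, SLOPE.IsEstimate X (SLOPE.lambdaBH p q)
        (fun j => X.mulVec β j + z j ω) (βhat ω)) →
      Integrable (fun ω => SLOPE.fdp β (βhat ω)) P ∧
      ∫ ω, SLOPE.fdp β (βhat ω) ∂P ≤ q * (SLOPE.numNulls β : ℝ) / (p : ℝ) := by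
  have hanti := SLOPE.lambdaBH_antitone (p := p) hq0 hq1
  have hnn := SLOPE.lambdaBH_nonneg (p := p) hq0 hq1
  refine ⟨fun y => ?_, fun βhat hβ => ?_⟩
  · simp only [SLOPE.isEstimate_iff hX]
    exact SLOPE.existsUnique_proxObjective_min hanti hnn _
  -- Writing the proportion as a fixed measurable function of `Xᵀy` gives measurability and moves
  -- the expectation to the product Gaussian measure.
  · have hfdp : (fun ω => SLOPE.fdp β (βhat ω)) = fun ω =>
        SLOPE.discoveryProportion (SLOPE.lambdaBH p q) β
          (X.transpose.mulVec fun j => X.mulVec β j + z j ω) := by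
      funext ω
      have hS := SLOPE.isLeastMaximizer_coordSupport hanti hnn
        ((SLOPE.isEstimate_iff hX _ _ _).1 (hβ ω))
      rw [hS.discoveryProportion_eq]
      simp only [SLOPE.mem_coordSupport]
      rfl
    have hlaw := SLOPE.hasLaw_transpose_mulVec_response hX β hz hind
    rw [hfdp]
    constructor
    · have hI := SLOPE.integrable_discoveryProportion (SLOPE.lambdaBH p q) β
        (Measure.pi fun i => gaussianReal (β i) 1)
      rw [← hlaw.map_eq] at hI
      exact hI.comp_aemeasurable hlaw.aemeasurable
    · have hE := hlaw.integral_comp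
        (SLOPE.measurable_discoveryProportion (SLOPE.lambdaBH p q) β).aestronglyMeasurable
      exact hE.trans_le (SLOPE.integral_discoveryProportion_le hq0 hq1 β _
        fun i hi => by rw [hi])
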